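/- Let $\chi_0,\chi_\infty\in\mathbb C$ be arbitrary constants and let $t_0\in\mathbb C$, $t_0\neq 0$. Consider the third Painlevé equation in the form $$(\mathrm{P3}')\qquad \ddot\lambda=\frac{\dot\lambda^2}{\lambda}-\frac{\dot\lambda}{t}-\frac{\chi_\infty\lambda^2}{t^2}+\frac{\lambda^3}{t^2}+\frac{\chi_0}{t}-\frac1\lambda .$$ A meromorphic solution on an open set $U\subseteq\mathbb C$ is a function meromorphic on $U$, not identically zero near any point of $U$, which satisfies $(\mathrm{P3}')$ at all points of $U$ outside a set with no accumulation point in $U$ (meromorphic functions are identified when they agree off such a set). Then there are exactly two families of meromorphic solutions with a simple pole at $t_0$, distinguished by the residue, and each is parametrized by one free complex constant: 1. If $\lambda$ is a meromorphic solution on an open neighbourhood of $t_0$ with a simple pole at $t_0$, then $\operatorname{Res}_{t_0}(\lambda)$ equals $t_0$ or $-t_0$, and $\lambda(t)-\operatorname{Res}_{t_0}(\lambda)/(t-t_0)$ extends analytically to $t_0$, so that $$D(\lambda)=\left.\frac{d}{dt}\left(\lambda(t)-\frac{\operatorname{Res}_{t_0}(\lambda)}{t-t_0}\right)\right|_{t=t_0}$$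 is well defined. 2. For each $\rho\in\{t_0,-t_0\}$ and each $c\in\mathbb C$ there is a meromorphic solution $\lambda$ on some open neighbourhood of $t_0$ with a simple pole at $t_0$, $\operatorname{Res}_{t_0}(\lambda)=\rho$ and $D(\lambda)=c$. 3. If two meromorphic solutions on a connected open set $U\ni t_0$ both have a simple pole at $t_0$, the same residue at $t_0$ and the same value of $D$, then they coincide on $U$. -/

import Mathlib

open Filter Topology

/-- The third Painlevé equation (in its primed form) with parameters `χ₀`, `χinf`, for the function
`w` at the point `t`. The right-hand side contains `1 / w t`, so `w t ≠ 0` is part of it. -/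
def PIIIPrimeAt (χ₀ χinf : ℂ) (w : ℂ → ℂ) (t : ℂ) : Prop :=
  w t ≠ 0 ∧
    deriv (deriv w) t = (deriv w t) ^ 2 / w t - deriv w t / t - χinf * (w t) ^ 2 / t ^ 2
      + (w t) ^ 3 / t ^ 2 + χ₀ / t - 1 / w t

/-- `w` is a meromorphic solution on `U`: it is meromorphic on `U` and satisfies the equation on `U`
off a set without accumulation points in `U` (its zeros and poles, where the equation itself
has no literal meaning). -/
structure IsMeromorphicSolutionOn (χ₀ χinf : ℂ) (w : ℂ → ℂ) (U : Set ℂ) : Prop where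
  meromorphicOn : MeromorphicOn w U
  equation : ∀ t ∈ U, ∀ᶠ z in 𝓝[≠] t, PIIIPrimeAt χ₀ χinf w z

/-- `w` has a simple pole at `t₀`. -/
def HasSimplePoleAt (w : ℂ → ℂ) (t₀ : ℂ) : Prop :=
  MeromorphicAt w t₀ ∧ meromorphicOrderAt w t₀ = -1

/-- The residue of `w` at an isolated singularity `t₀`: the common value of the integrals
`(2πi)⁻¹ ∮ w(z) dz` over all sufficiently small circles around `t₀`. -/
noncomputable def residueAt (w : ℂ → ℂ) (t₀ : ℂ) : ℂ :=
  limUnder (𝓝[>] (0 : ℝ)) fun r => (2 * Real.pi * Complex.I)⁻¹ * ∮ z in C(t₀, r), w z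

/-- The function `w(t) - Res_{t₀}(w) / (t - t₀)`, with its value at `t₀` filled in so
that a removable singularity there is removed. -/
noncomputable def regularPartAt (w : ℂ → ℂ) (t₀ : ℂ) : ℂ → ℂ :=
  toMeromorphicNFAt (fun t => w t - residueAt w t₀ / (t - t₀)) t₀

/-! Poles are made regular initial points of another system. The leading terms of the equation at a
simple pole force the squared residue to be `t₀ ^ 2`, so the residue is `ε * t₀` with `ε ^ 2 = 1`.
For this `ε`, put `u = 1 / w` and let `x` be the Riccati defect of `w`. The pair `(u, x)` satisfies
a first-order system, polynomial in `u` and `x` with coefficients holomorphic at `t₀ ≠ 0`, and `x`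
stays analytic at the pole (`exists_analyticAt_riccatiDefect`). A simple pole of residue `ε * t₀`
thus corresponds to initial data `u = 0`, `x = x₀` with `x₀` free. By
`deriv_dslope_of_riccatiDefect`, the derivative of the regular part is an affine bijective function
of `x₀`. Existence and local uniqueness are then those of the Cauchy problem; the identity theorem
spreads uniqueness over the connected set. -/

/-! ### Holomorphic differential equations: uniqueness and existence. -/

/-- Two solutions of a complex differential equation with the same initial value agree near the
initial point. -/
theorem eventuallyEq_of_hasDerivAt_of_contDiffAt {E : Type*} [NormedAddCommGroup E]
    [NormedSpace ℂ E] {f : E → E} {y₁ y₂ : ℂ → E} {t₀ : ℂ}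
    (hf : ContDiffAt ℂ 1 f (y₁ t₀)) (h₀ : y₁ t₀ = y₂ t₀)
    (h₁ : ∀ᶠ z in 𝓝 t₀, HasDerivAt y₁ (f (y₁ z)) z)
    (h₂ : ∀ᶠ z in 𝓝 t₀, HasDerivAt y₂ (f (y₂ z)) z) : y₁ =ᶠ[𝓝 t₀] y₂ := by
  obtain ⟨K, s, hs, hK⟩ := hf.exists_lipschitzOnWith
  have e₁ := h₁.self_of_nhds.continuousAt.eventually hs
  have e₂ := h₂.self_of_nhds.continuousAt.eventually (h₀ ▸ hs)
  obtain ⟨r, hr, hball⟩ := Metric.eventually_nhds_iff_ball.1 ((h₁.and h₂).and (e₁.and e₂))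
  -- With `ρ * K ≤ 1 / 2`, the maximum of `‖y₁ - y₂‖` on the disc is at most half of itself, hence
  -- zero.
  set ρ : ℝ := min (r / 2) (1 / (2 * (K + 1))) with hρ
  have hKpos : (0 : ℝ) < 2 * (K + 1) := by positivity
  have hρpos : 0 < ρ := lt_min (by positivity) (by positivity)
  have hρK : ρ * K ≤ 1 / 2 := by
    have : ρ ≤ 1 / (2 * (K + 1)) := min_le_right _ _
    rw [le_div_iff₀ hKpos] at this
    nlinarith
  have hsub : Metric.closedBall t₀ ρ ⊆ Metric.ball t₀ r :=
    Metric.closedBall_subset_ball ((min_le_left _ _).trans_lt (by linarith))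
  have hd : ∀ z ∈ Metric.closedBall t₀ ρ,
      HasDerivAt (fun z => y₁ z - y₂ z) (f (y₁ z) - f (y₂ z)) z := fun z hz =>
    (hball z (hsub hz)).1.1.sub (hball z (hsub hz)).1.2
  obtain ⟨m, hm, hmax⟩ := (isCompact_closedBall t₀ ρ).exists_isMaxOn
    ⟨t₀, Metric.mem_closedBall_self hρpos.le⟩
    (f := fun z => ‖y₁ z - y₂ z‖)
    (ContinuousOn.norm fun z hz => (hd z hz).continuousAt.continuousWithinAt)
  have hbound : ∀ z ∈ Metric.closedBall t₀ ρ, ‖f (y₁ z) - f (y₂ z)‖ ≤ K * ‖y₁ m - y₂ m‖ := by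
    intro z hz
    refine (hK.norm_sub_le (hball z (hsub hz)).2.1 (hball z (hsub hz)).2.2).trans ?_
    exact mul_le_mul_of_nonneg_left (hmax hz) K.2
  have key := (convex_closedBall t₀ ρ).norm_image_sub_le_of_norm_hasDerivWithin_le
    (fun z hz => (hd z hz).hasDerivWithinAt) hbound (Metric.mem_closedBall_self hρpos.le) hm
  have hmt : ‖m - t₀‖ ≤ ρ := by simpa [dist_eq_norm] using hm
  have hzero : ‖y₁ m - y₂ m‖ ≤ 0 := by
    rw [h₀, sub_self, sub_zero] at key
    have h3 : K * ‖y₁ m - y₂ m‖ * ‖m - t₀‖ ≤ K * ‖y₁ m - y₂ m‖ * ρ := by gcongr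
    nlinarith [norm_nonneg (y₁ m - y₂ m)]
  filter_upwards [Metric.closedBall_mem_nhds t₀ hρpos] with z hz
  exact sub_eq_zero.1 (norm_le_zero_iff.1 ((hmax hz).trans hzero))

/-- The Cauchy–Picard theorem: local existence of a holomorphic solution of a complex differential
equation. -/
theorem exists_forall_hasDerivAt_ball_of_contDiffAt {E : Type*} [NormedAddCommGroup E]
    [NormedSpace ℂ E] [CompleteSpace E] {f : E → E} {y₀ : E} (hf : ContDiffAt ℂ 1 f y₀) (t₀ : ℂ) :
    ∃ r > 0, ∃ y : ℂ → E, y t₀ = y₀ ∧ ∀ z ∈ Metric.ball t₀ r, HasDerivAt y (f (y z)) z := by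
  obtain ⟨K, s, hs, hK⟩ := hf.exists_lipschitzOnWith
  have hdiff : ∀ᶠ y in 𝓝 y₀, DifferentiableAt ℂ f y :=
    (hf.eventually (by simp)).mono fun y hy => hy.differentiableAt (by simp)
  have hbdd : ∀ᶠ y in 𝓝 y₀, ‖f y‖ < ‖f y₀‖ + 1 :=
    hf.continuousAt.norm.eventually_lt_const (lt_add_one _)
  obtain ⟨a, ha, hball⟩ := Metric.nhds_basis_closedBall.eventually_iff.1
    ((hdiff.and hbdd).and hs)
  set M : ℝ := ‖f y₀‖ + 1
  have hM : 0 < M := by positivity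
  -- The first bound keeps Picard iterates in the ball of radius `a`; the second makes the Picard
  -- map contract by `1 / 2`.
  set r : ℝ := min (a / M) (1 / (2 * (K + 1))) with hr
  have hKpos : (0 : ℝ) < 2 * (K + 1) := by positivity
  have hrpos : 0 < r := lt_min (by positivity) (by positivity)
  have hrK : K * r ≤ 1 / 2 := by
    have : r ≤ 1 / (2 * (K + 1)) := min_le_right _ _
    rw [le_div_iff₀ hKpos] at this
    nlinarith
  have hrM : M * r ≤ a := by
    have : r ≤ a / M := min_le_left _ _
    rw [le_div_iff₀ hM] at this
    linarith
  set B := Metric.ball t₀ r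
  have ht₀ : t₀ ∈ B := Metric.mem_ball_self hrpos
  let S := {y : ℂ → E // y t₀ = y₀ ∧ DifferentiableOn ℂ y B ∧
    Set.MapsTo y B (Metric.closedBall y₀ a)}
  -- The Picard map: a holomorphic function on a disc has a primitive, which replaces the integral
  -- from `t₀`.
  have hstep : ∀ y : S, ∃ g : S, ∀ z ∈ B, HasDerivAt g.1 (f (y.1 z)) z := by
    rintro ⟨y, hy0, hyd, hym⟩
    have hc : DifferentiableOn ℂ (fun z => f (y z)) B := fun z hz =>
      ((hball (hym hz)).1.1).comp_differentiableWithinAt z (hyd z hz)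
    obtain ⟨g, hg0, hg⟩ := hc.isExactOn_ball.with_val_at t₀ y₀
    refine ⟨⟨g, hg0, fun z hz => (hg z hz).differentiableAt.differentiableWithinAt,
      fun z hz => ?_⟩, hg⟩
    have := (convex_ball t₀ r).norm_image_sub_le_of_norm_hasDerivWithin_le
      (fun z hz => (hg z hz).hasDerivWithinAt) (fun z hz => (hball (hym hz)).1.2.le) ht₀ hz
    have hz' : ‖z - t₀‖ ≤ r := by simpa [B, dist_eq_norm] using (Metric.mem_ball.1 hz).le
    rw [hg0] at this
    rw [Metric.mem_closedBall, dist_eq_norm]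
    exact this.trans ((mul_le_mul_of_nonneg_left hz' hM.le).trans hrM)
  choose T hT using hstep
  let y : ℕ → S := fun n => T^[n] ⟨fun _ => y₀, rfl, differentiableOn_const _,
    fun z _ => Metric.mem_closedBall_self ha.le⟩
  have hy : ∀ n, ∀ z ∈ B, HasDerivAt (y (n + 1)).1 (f ((y n).1 z)) z := by
    intro n
    simp only [y, Function.iterate_succ_apply']
    exact hT _
  have hmem : ∀ n, ∀ z ∈ B, (y n).1 z ∈ s := fun n z hz => (hball ((y n).2.2.2 hz)).2
  have hgeo : ∀ n, ∀ z ∈ B, dist ((y n).1 z) ((y (n + 1)).1 z) ≤ (2 * a) * (1 / 2) ^ n := by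
    intro n
    induction n with
    | zero =>
      intro z hz
      have h1 := (y 0).2.2.2 hz
      have h2 := (y 1).2.2.2 hz
      have := dist_triangle_right ((y 0).1 z) ((y 1).1 z) y₀
      rw [Metric.mem_closedBall] at h1 h2
      simpa using by linarith
    | succ n ih =>
      intro z hz
      have := (convex_ball t₀ r).norm_image_sub_le_of_norm_hasDerivWithin_le
        (f := fun z => (y (n + 1)).1 z - (y (n + 2)).1 z)
        (C := K * ((2 * a) * (1 / 2) ^ n))
        (fun z hz => ((hy n z hz).sub (hy (n + 1) z hz)).hasDerivWithinAt)
        (fun z hz => (hK.norm_sub_le (hmem n z hz) (hmem (n + 1) z hz)).trans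
          (mul_le_mul_of_nonneg_left (by simpa [dist_eq_norm] using ih z hz) K.2)) ht₀ hz
      have hz' : ‖z - t₀‖ ≤ r := by simpa [B, dist_eq_norm] using (Metric.mem_ball.1 hz).le
      simp only [(y (n + 1)).2.1, (y (n + 2)).2.1, sub_self, sub_zero] at this
      rw [dist_eq_norm]
      refine this.trans ?_
      calc K * ((2 * a) * (1 / 2) ^ n) * ‖z - t₀‖ ≤ K * ((2 * a) * (1 / 2) ^ n) * r := by gcongr
        _ = (K * r) * ((2 * a) * (1 / 2) ^ n) := by ring
        _ ≤ 1 / 2 * ((2 * a) * (1 / 2) ^ n) := by gcongr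
        _ = (2 * a) * (1 / 2) ^ (n + 1) := by ring
  have hlim : ∀ z ∈ B, ∃ l, Tendsto (fun n => (y n).1 z) atTop (𝓝 l) := fun z hz =>
    cauchySeq_tendsto_of_complete
      (cauchySeq_of_le_geometric (1 / 2) (2 * a) (by norm_num) fun n => hgeo n z hz)
  choose! Y hY using hlim
  have hYs : ∀ z ∈ B, Y z ∈ s := fun z hz => (hball (Metric.isClosed_closedBall.mem_of_tendsto
    (hY z hz) (Eventually.of_forall fun n => (y n).2.2.2 hz))).2
  -- Uniform convergence of the derivatives lets the limit of the iterates be differentiated.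
  have hunif : TendstoUniformlyOn (fun n z => f ((y n).1 z)) (fun z => f (Y z)) atTop B := by
    rw [Metric.tendstoUniformlyOn_iff]
    intro ε hε
    have hpow : Tendsto (fun n : ℕ => K * (2 * a * (1 / 2) ^ n / (1 - 1 / 2))) atTop (𝓝 0) := by
      have := tendsto_pow_atTop_nhds_zero_of_lt_one (r := (1 / 2 : ℝ)) (by norm_num) (by norm_num)
      simpa using (((this.const_mul (2 * a)).div_const (1 - 1 / 2)).const_mul (K : ℝ))
    filter_upwards [hpow.eventually_lt_const hε] with n hn z hz
    rw [dist_comm]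
    refine ((hK.dist_le_mul _ (hmem n z hz) _ (hYs z hz)).trans ?_).trans_lt hn
    exact mul_le_mul_of_nonneg_left (dist_le_of_le_geometric_of_tendsto (1 / 2) (2 * a)
      (by norm_num) (fun n => hgeo n z hz) (hY z hz) n) K.2
  refine ⟨r, hrpos, Y, ?_, ?_⟩
  · refine tendsto_nhds_unique (hY t₀ ht₀) ?_
    simp only [fun n => (y n).2.1, tendsto_const_nhds]
  · exact fun z hz => hasDerivAt_of_tendstoUniformlyOn Metric.isOpen_ball hunif
      (Eventually.of_forall fun n z hz => hy n z hz)
      (fun z hz => (hY z hz).comp (tendsto_add_atTop_nat 1)) hz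

/-! ### Local form of a function at a simple pole. -/

theorem AnalyticAt.dslope_self {h : ℂ → ℂ} {t₀ : ℂ} (hh : AnalyticAt ℂ h t₀) :
    AnalyticAt ℂ (dslope h t₀) t₀ := by
  obtain ⟨p, hp⟩ := hh
  exact ⟨_, hp.has_fpower_series_dslope_fslope⟩

/-- Carries identities, once cleared of denominators, from the punctured neighbourhood to the pole
itself, where they can be evaluated or differentiated. -/
theorem AnalyticAt.eventuallyEq_nhds {f g : ℂ → ℂ} {t₀ : ℂ} (hf : AnalyticAt ℂ f t₀)
    (hg : AnalyticAt ℂ g t₀) (h : f =ᶠ[𝓝[≠] t₀] g) : f =ᶠ[𝓝 t₀] g :=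
  (hf.frequently_eq_iff_eventually_eq hg).1 h.frequently

/-- A property holding near `t₀` off `t₀` holds near every point close to `t₀` and different from
it. -/
theorem eventually_nhdsNE_eventually_nhds {p : ℂ → Prop} {t₀ : ℂ} (h : ∀ᶠ z in 𝓝[≠] t₀, p z) :
    ∀ᶠ z in 𝓝[≠] t₀, ∀ᶠ y in 𝓝 z, p y := by
  filter_upwards [eventually_eventually_nhdsWithin.2 h, self_mem_nhdsWithin] with z hz hne
  rwa [IsOpen.nhdsWithin_eq isOpen_compl_singleton hne] at hz

theorem HasSimplePoleAt.exists_analyticAt_div {w : ℂ → ℂ} {t₀ : ℂ} (hw : HasSimplePoleAt w t₀) :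
    ∃ h, AnalyticAt ℂ h t₀ ∧ h t₀ ≠ 0 ∧ w =ᶠ[𝓝[≠] t₀] fun t => h t / (t - t₀) := by
  obtain ⟨h, hh, h0, he⟩ := (meromorphicOrderAt_eq_int_iff (n := -1) hw.1).1 (by simpa using hw.2)
  refine ⟨h, hh, h0, he.mono fun z hz => ?_⟩
  simp [hz, div_eq_inv_mul]

section SimplePole

variable {w h : ℂ → ℂ} {t₀ : ℂ}

theorem hasSimplePoleAt_of_eventuallyEq_div (hh : AnalyticAt ℂ h t₀) (h0 : h t₀ ≠ 0)
    (hw : w =ᶠ[𝓝[≠] t₀] fun t => h t / (t - t₀)) : HasSimplePoleAt w t₀ := by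
  have hm : MeromorphicAt w t₀ :=
    MeromorphicAt.congr (by fun_prop) hw.symm
  refine ⟨hm, ?_⟩
  have := (meromorphicOrderAt_eq_int_iff (n := -1) hm).2 ⟨h, hh, h0, hw.mono fun z hz => by
    simp [hz, div_eq_inv_mul]⟩
  simpa using this

theorem residueAt_eq_of_eventuallyEq_div (hh : AnalyticAt ℂ h t₀)
    (hw : w =ᶠ[𝓝[≠] t₀] fun t => h t / (t - t₀)) : residueAt w t₀ = h t₀ := by
  obtain ⟨r, hr, hball⟩ := Metric.eventually_nhds_iff_ball.1
    (hh.eventually_analyticAt.and (eventually_nhdsWithin_iff.1 hw))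
  refine (tendsto_const_nhds.congr' ?_).limUnder_eq
  filter_upwards [Ioo_mem_nhdsGT hr] with R hR
  have hsub : Metric.closedBall t₀ R ⊆ Metric.ball t₀ r := Metric.closedBall_subset_ball hR.2
  have hd : DifferentiableOn ℂ h (Metric.closedBall t₀ R) := fun z hz =>
    (hball z (hsub hz)).1.differentiableAt.differentiableWithinAt
  have hc := hd.circleIntegral_sub_inv_smul (Metric.mem_ball_self hR.1)
  have hcongr : (∮ z in C(t₀, R), w z) = ∮ z in C(t₀, R), (z - t₀)⁻¹ • h z := by
    refine circleIntegral.integral_congr hR.1.le fun z hz => ?_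
    have hne : z ≠ t₀ := by
      rintro rfl
      simp at hz
      exact hR.1.ne hz
    rw [(hball z (hsub (Metric.sphere_subset_closedBall hz))).2 hne, smul_eq_mul]
    exact div_eq_inv_mul _ _
  rw [hcongr, hc, smul_eq_mul]
  field_simp [Real.pi_ne_zero]

theorem regularPartAt_eventuallyEq (hh : AnalyticAt ℂ h t₀)
    (hw : w =ᶠ[𝓝[≠] t₀] fun t => h t / (t - t₀)) : regularPartAt w t₀ =ᶠ[𝓝 t₀] dslope h t₀ := by
  have he : (fun t => w t - residueAt w t₀ / (t - t₀)) =ᶠ[𝓝[≠] t₀] dslope h t₀ := by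
    filter_upwards [hw, self_mem_nhdsWithin] with z hz hne
    rw [hz, residueAt_eq_of_eventuallyEq_div hh hw, dslope_of_ne _ hne, slope_def_field, sub_div]
  have := toMeromorphicNFAt_eventuallyEq_nhds_congr he
  rwa [toMeromorphicNFAt_eq_self.2 hh.dslope_self.meromorphicNFAt] at this

theorem deriv_of_eventuallyEq_div (hh : AnalyticAt ℂ h t₀)
    (hw : w =ᶠ[𝓝[≠] t₀] fun t => h t / (t - t₀)) :
    ∀ᶠ z in 𝓝[≠] t₀, deriv w z = (deriv h z * (z - t₀) - h z) / (z - t₀) ^ 2 := by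
  filter_upwards [eventually_nhdsNE_eventually_nhds hw, self_mem_nhdsWithin,
    hh.eventually_analyticAt.filter_mono nhdsWithin_le_nhds] with z hz hne hhz
  have hne' : z - t₀ ≠ 0 := sub_ne_zero.2 hne
  have h1 := hhz.differentiableAt.hasDerivAt.div ((hasDerivAt_id z).sub_const t₀) hne'
  have h2 : deriv w z = _ := Filter.EventuallyEq.deriv_eq hz
  rw [h2]
  refine h1.deriv.trans ?_
  simp

theorem deriv_deriv_of_eventuallyEq_div (hh : AnalyticAt ℂ h t₀)
    (hw : w =ᶠ[𝓝[≠] t₀] fun t => h t / (t - t₀)) :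
    ∀ᶠ z in 𝓝[≠] t₀, deriv (deriv w) z =
      (deriv (deriv h) z * (z - t₀) ^ 2 - 2 * deriv h z * (z - t₀) + 2 * h z) / (z - t₀) ^ 3 := by
  filter_upwards [eventually_nhdsNE_eventually_nhds (deriv_of_eventuallyEq_div hh hw),
    self_mem_nhdsWithin, hh.eventually_analyticAt.filter_mono nhdsWithin_le_nhds] with z hz hne hhz
  have hne' : z - t₀ ≠ 0 := sub_ne_zero.2 hne
  have hs := (hasDerivAt_id z).sub_const t₀
  have h1 := ((hhz.deriv.differentiableAt.hasDerivAt.mul hs).sub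
    hhz.differentiableAt.hasDerivAt).div (hs.pow 2) (pow_ne_zero 2 hne')
  have h2 : deriv (deriv w) z = _ := Filter.EventuallyEq.deriv_eq hz
  rw [h2]
  refine h1.deriv.trans ?_
  simp only [id, Pi.pow_apply, Pi.sub_apply, Pi.mul_apply]
  field_simp
  push_cast
  ring

end SimplePole

/-! ### The Riccati defect and its behaviour at a pole. -/

/-- The amount by which `w` fails to satisfy the Riccati equation
`w' = -(ε / t) w ^ 2 + (ε χinf / t) w`. -/
noncomputable def riccatiDefect (ε χinf : ℂ) (w : ℂ → ℂ) (t : ℂ) : ℂ :=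
  -deriv w t - ε / t * w t ^ 2 + ε * χinf / t * w t

/-- Both signs of `ε` work because the quadratic and cubic terms of the equation receive `ε` only
through `ε ^ 2 = 1`. -/
theorem pIIIPrimeAt_iff_deriv_riccatiDefect {ε χ₀ χinf z : ℂ} {w : ℂ → ℂ} (hε : ε ^ 2 = 1)
    (hz : z ≠ 0) (hw : AnalyticAt ℂ w z) (hwz : w z ≠ 0) :
    PIIIPrimeAt χ₀ χinf w z ↔ deriv (riccatiDefect ε χinf w) z * w z =
      (-1 + ε * χinf) / z * riccatiDefect ε χinf w z * w z - χ₀ / z * w z + 1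
        - riccatiDefect ε χinf w z ^ 2 := by
  have h1 := hw.differentiableAt.hasDerivAt
  have h2 := hw.deriv.differentiableAt.hasDerivAt
  have hi := hasDerivAt_inv hz
  have hd : HasDerivAt (riccatiDefect ε χinf w) _ z :=
    ((h2.neg.sub (((hi.const_mul ε)).mul (h1.pow 2))).add ((hi.const_mul (ε * χinf)).mul h1))
      |>.congr_of_eventuallyEq (Eventually.of_forall fun t => by
        simp [riccatiDefect, div_eq_mul_inv])
  rw [hd.deriv, PIIIPrimeAt, and_iff_right hwz]
  simp only [riccatiDefect, Pi.pow_apply]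
  generalize deriv (deriv w) z = w2
  generalize deriv w z = w1 at *
  generalize w z = w0 at *
  have e1 : w0 * (w1 ^ 2 / w0) = w1 ^ 2 := mul_div_cancel₀ _ hwz
  have e2 : w0 * (1 / w0) = 1 := mul_div_cancel₀ _ hwz
  push_cast
  rw [← sub_eq_zero, ← mul_right_inj' (neg_ne_zero.2 hwz), mul_zero]
  nth_rw 2 [← sub_eq_zero]
  refine Eq.congr_left ?_
  linear_combination (-(w0 ^ 4 - χinf * w0 ^ 3) / z ^ 2) * hε + e1 - e2

section SimplePole

variable {w h : ℂ → ℂ} {t₀ : ℂ}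

theorem eventually_analyticAt_of_eventuallyEq_div (hh : AnalyticAt ℂ h t₀) (h0 : h t₀ ≠ 0)
    (hw : w =ᶠ[𝓝[≠] t₀] fun t => h t / (t - t₀)) :
    ∀ᶠ z in 𝓝[≠] t₀, AnalyticAt ℂ w z ∧ w z ≠ 0 := by
  filter_upwards [eventually_nhdsNE_eventually_nhds hw, self_mem_nhdsWithin,
    hh.eventually_analyticAt.filter_mono nhdsWithin_le_nhds,
    (hh.continuousAt.eventually_ne h0).filter_mono nhdsWithin_le_nhds] with z hz hne hhz h0z
  have hne' : z - t₀ ≠ 0 := sub_ne_zero.2 hne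
  refine ⟨(hhz.div (by fun_prop) hne').congr (EventuallyEq.symm hz), ?_⟩
  rw [hz.self_of_nhds]
  exact div_ne_zero h0z hne'

/-- Multiplying the equation by `w z * (z - t₀) ^ 4 * z ^ 2` leaves at `t₀` only `w'' w`, `w' ^ 2`
and `w ^ 4`, giving `2 h² t₀² = h² t₀² + h⁴`. -/
theorem residue_sq_eq {χ₀ χinf : ℂ} (ht₀ : t₀ ≠ 0) (hh : AnalyticAt ℂ h t₀) (h0 : h t₀ ≠ 0)
    (hw : w =ᶠ[𝓝[≠] t₀] fun t => h t / (t - t₀))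
    (he : ∀ᶠ z in 𝓝[≠] t₀, PIIIPrimeAt χ₀ χinf w z) : h t₀ ^ 2 = t₀ ^ 2 := by
  have hd := hh.deriv
  have hdd := hh.deriv.deriv
  have key : (fun z => h z * (deriv (deriv h) z * (z - t₀) ^ 2 - 2 * deriv h z * (z - t₀)
        + 2 * h z) * z ^ 2) =ᶠ[𝓝[≠] t₀]
      fun z => (deriv h z * (z - t₀) - h z) ^ 2 * z ^ 2
        - z * (z - t₀) * h z * (deriv h z * (z - t₀) - h z)
        - χinf * (z - t₀) * h z ^ 3 + h z ^ 4 + χ₀ * z * (z - t₀) ^ 3 * h z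
        - (z - t₀) ^ 4 * z ^ 2 := by
    filter_upwards [hw, deriv_of_eventuallyEq_div hh hw, deriv_deriv_of_eventuallyEq_div hh hw,
      he, self_mem_nhdsWithin, (hh.continuousAt.eventually_ne h0).filter_mono nhdsWithin_le_nhds,
      (continuousAt_id.eventually_ne ht₀).filter_mono nhdsWithin_le_nhds]
      with z hz h1 h2 heq hne h0z hz0
    have hs : z - t₀ ≠ 0 := sub_ne_zero.2 hne
    have heq := heq.2
    simp only [id] at hz0
    rw [h2, h1, hz] at heq
    generalize z - t₀ = s at *
    field_simp at heq
    linear_combination heq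
  have := (AnalyticAt.eventuallyEq_nhds (by fun_prop) (by fun_prop) key).self_of_nhds
  simp only [sub_self] at this
  refine mul_left_cancel₀ (pow_ne_zero 2 h0) ?_
  linear_combination -this

theorem riccatiDefect_eventuallyEq_div (ε χinf : ℂ) (hh : AnalyticAt ℂ h t₀)
    (hw : w =ᶠ[𝓝[≠] t₀] fun t => h t / (t - t₀)) :
    ∀ᶠ z in 𝓝[≠] t₀, riccatiDefect ε χinf w z = (-(deriv h z * (z - t₀) - h z)
      - ε / z * h z ^ 2 + ε * χinf / z * (z - t₀) * h z) / (z - t₀) ^ 2 := by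
  filter_upwards [hw, deriv_of_eventuallyEq_div hh hw, self_mem_nhdsWithin] with z hz h1 hne
  have hs : z - t₀ ≠ 0 := sub_ne_zero.2 hne
  rw [riccatiDefect, h1, hz]
  field_simp

/-- Along a solution with a pole of residue `ε t₀`, the Riccati defect extends analytically over
the pole. -/
theorem exists_analyticAt_riccatiDefect {ε χ₀ χinf : ℂ} (hε : ε ^ 2 = 1) (ht₀ : t₀ ≠ 0)
    (hh : AnalyticAt ℂ h t₀) (h0 : h t₀ = ε * t₀)
    (hw : w =ᶠ[𝓝[≠] t₀] fun t => h t / (t - t₀))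
    (he : ∀ᶠ z in 𝓝[≠] t₀, PIIIPrimeAt χ₀ χinf w z) :
    ∃ x, AnalyticAt ℂ x t₀ ∧ riccatiDefect ε χinf w =ᶠ[𝓝[≠] t₀] x := by
  have hε0 : ε ≠ 0 := by rintro rfl; simp at hε
  have h0' : h t₀ ≠ 0 := by rw [h0]; exact mul_ne_zero hε0 ht₀
  have hd := hh.deriv
  set N : ℂ → ℂ := fun z => -(deriv h z * (z - t₀) - h z)
      - ε / z * h z ^ 2 + ε * χinf / z * (z - t₀) * h z with hN
  have hNa : AnalyticAt ℂ N t₀ := by fun_prop (disch := assumption)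
  -- The residue `ε * t₀` cancels the double pole of the defect, leaving at most a simple one.
  have hN0 : N t₀ = 0 := by
    simp only [hN, h0, sub_self, mul_zero, zero_mul]
    field_simp
    linear_combination (-ε * t₀) * hε
  have hq := hNa.dslope_self
  have hX : riccatiDefect ε χinf w =ᶠ[𝓝[≠] t₀] fun t => dslope N t₀ t / (t - t₀) := by
    filter_upwards [riccatiDefect_eventuallyEq_div ε χinf hh hw, self_mem_nhdsWithin] with z hz hne
    have hs : z - t₀ ≠ 0 := sub_ne_zero.2 hne
    change _ = N z / _ at hz
    rw [hz, dslope_of_ne _ hne, slope_def_field, hN0, sub_zero]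
    field_simp
  generalize dslope N t₀ = q at hq hX
  have hdq := hq.deriv
  have key : (fun z => (deriv q z * (z - t₀) - q z) * h z) =ᶠ[𝓝[≠] t₀] fun z =>
      (-1 + ε * χinf) / z * (z - t₀) * q z * h z - χ₀ / z * (z - t₀) ^ 2 * h z + (z - t₀) ^ 3
        - q z ^ 2 * (z - t₀) := by
    filter_upwards [hw, hX, deriv_of_eventuallyEq_div hq hX, he,
      eventually_analyticAt_of_eventuallyEq_div hh h0' hw, self_mem_nhdsWithin,
      (continuousAt_id.eventually_ne ht₀).filter_mono nhdsWithin_le_nhds]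
      with z hz hXz hX' heq hwz hne hz0
    have hs : z - t₀ ≠ 0 := sub_ne_zero.2 hne
    simp only [id] at hz0
    rw [pIIIPrimeAt_iff_deriv_riccatiDefect hε hz0 hwz.1 hwz.2, hX', hXz, hz] at heq
    generalize z - t₀ = s at *
    field_simp at heq ⊢
    linear_combination heq
  have h1 := (AnalyticAt.eventuallyEq_nhds (by fun_prop)
    (by fun_prop (disch := assumption)) key).self_of_nhds
  -- A simple pole would give `x' w` a triple pole that no other term of the equation can balance.
  have hq0 : q t₀ = 0 := by simpa [h0'] using h1
  refine ⟨dslope q t₀, hq.dslope_self, ?_⟩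
  filter_upwards [hX, self_mem_nhdsWithin] with z hz hne
  rw [hz, dslope_of_ne _ hne, slope_def_field, hq0, sub_zero]

/-- The derivative of the regular part in terms of the value of the Riccati defect at the pole. -/
theorem deriv_dslope_of_riccatiDefect {ε χinf : ℂ} {x : ℂ → ℂ} (hε : ε ^ 2 = 1) (ht₀ : t₀ ≠ 0)
    (hh : AnalyticAt ℂ h t₀) (h0 : h t₀ = ε * t₀)
    (hw : w =ᶠ[𝓝[≠] t₀] fun t => h t / (t - t₀)) (hx : AnalyticAt ℂ x t₀)
    (hX : riccatiDefect ε χinf w =ᶠ[𝓝[≠] t₀] x) :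
    deriv (dslope h t₀) t₀ = -(x t₀) / 3
      - ε * ((ε + χinf) / 2 * ((ε + χinf) / 2 - χinf)) / (3 * t₀) := by
  have hR := hh.dslope_self
  have hRw : ∀ z, h z = h t₀ + (z - t₀) * dslope h t₀ z := fun z => by
    linear_combination -(sub_smul_dslope h t₀ z)
  generalize dslope h t₀ = R at hR hRw
  have hdR := hR.deriv
  have hdh : ∀ᶠ z in 𝓝 t₀, deriv h z = R z + (z - t₀) * deriv R z := by
    filter_upwards [hR.eventually_analyticAt] with z hz
    have h1 := (((hasDerivAt_id z).sub_const t₀).mul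
      hz.differentiableAt.hasDerivAt).const_add (h t₀)
    rw [show h = _ from funext hRw]
    refine h1.deriv.trans ?_
    simp
  set A : ℂ → ℂ := fun z => z * deriv R z + ε * R z ^ 2 - ε * χinf * R z + z * x z with hA
  have hAa : AnalyticAt ℂ A t₀ := by fun_prop
  -- The definition of the defect rewritten for `w = ε t₀ / (z - t₀) + R`. Its value at `t₀` gives
  -- `R t₀`; its derivative there gives `R' t₀` in terms of `x t₀`.
  have key : (fun z => (z - t₀) * A z) =ᶠ[𝓝 t₀]
      fun z => ε * t₀ - 2 * t₀ * R z + t₀ * χinf := by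
    refine AnalyticAt.eventuallyEq_nhds (by fun_prop) (by fun_prop) ?_
    filter_upwards [riccatiDefect_eventuallyEq_div ε χinf hh hw, hX,
      hdh.filter_mono nhdsWithin_le_nhds, self_mem_nhdsWithin,
      (continuousAt_id.eventually_ne ht₀).filter_mono nhdsWithin_le_nhds]
      with z h1 h2 h3 hne hz0
    have hs : z - t₀ ≠ 0 := sub_ne_zero.2 hne
    simp only [id] at hz0
    rw [h2, h3, hRw z, h0, eq_div_iff (pow_ne_zero 2 hs)] at h1
    refine mul_left_cancel₀ hs ?_
    field_simp at h1
    simp only [hA]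
    linear_combination h1 + (-ε * t₀ ^ 2 - 2 * t₀ * (z - t₀) * R z + χinf * (z - t₀) * t₀) * hε
  have hval : R t₀ = (ε + χinf) / 2 := by
    have := key.self_of_nhds
    simp only [sub_self, zero_mul] at this
    refine mul_left_cancel₀ ht₀ ?_
    linear_combination this / 2
  have hder := key.deriv_eq
  have hl : deriv (fun z => (z - t₀) * A z) t₀ = A t₀ := by
    refine (((hasDerivAt_id t₀).sub_const t₀).mul hAa.differentiableAt.hasDerivAt).deriv.trans ?_
    simp
  have hr : deriv (fun z => ε * t₀ - 2 * t₀ * R z + t₀ * χinf) t₀ = -(2 * t₀ * deriv R t₀) :=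
    (((hR.differentiableAt.hasDerivAt.const_mul (2 * t₀)).const_sub (ε * t₀)).add_const
      (t₀ * χinf)).deriv
  rw [hl, hr] at hder
  simp only [hA, hval] at hder
  field_simp
  linear_combination 4 * hder

end SimplePole

/-! ### The regular system and its solutions through the pole. -/

/-- The regular system satisfied by `(t, 1 / w, x)`, where `x` is the Riccati defect of a solution
`w` of the third Painlevé equation. -/
noncomputable def pIIIField (ε χ₀ χinf : ℂ) (p : ℂ × ℂ × ℂ) : ℂ × ℂ × ℂ :=
  (1, ε / p.1 - ε * χinf / p.1 * p.2.1 + p.2.1 ^ 2 * p.2.2,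
    (-1 + ε * χinf) / p.1 * p.2.2 - χ₀ / p.1 + p.2.1 - p.2.1 * p.2.2 ^ 2)

theorem contDiffAt_pIIIField (ε χ₀ χinf : ℂ) {p : ℂ × ℂ × ℂ} (hp : p.1 ≠ 0) :
    ContDiffAt ℂ 1 (pIIIField ε χ₀ χinf) p := by
  unfold pIIIField
  fun_prop (disch := assumption)

/-- Away from `t₀` this is the definition of the defect together with its first-order equation;
analyticity of `1 / w` and `x` extends it to `t₀`. -/
theorem eventually_hasDerivAt_pIIIField {ε χ₀ χinf t₀ : ℂ} {w h x : ℂ → ℂ} (hε : ε ^ 2 = 1)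
    (ht₀ : t₀ ≠ 0) (hh : AnalyticAt ℂ h t₀) (h0 : h t₀ ≠ 0)
    (hw : w =ᶠ[𝓝[≠] t₀] fun t => h t / (t - t₀))
    (he : ∀ᶠ z in 𝓝[≠] t₀, PIIIPrimeAt χ₀ χinf w z) (hx : AnalyticAt ℂ x t₀)
    (hX : riccatiDefect ε χinf w =ᶠ[𝓝[≠] t₀] x) :
    ∀ᶠ z in 𝓝 t₀, HasDerivAt (fun t => (t, (t - t₀) / h t, x t))
      (pIIIField ε χ₀ χinf (z, (z - t₀) / h z, x z)) z := by
  set u : ℂ → ℂ := fun t => (t - t₀) / h t with hu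
  have hua : AnalyticAt ℂ u t₀ := by fun_prop (disch := assumption)
  have hdu := hua.deriv
  have hdx := hx.deriv
  have huw : u =ᶠ[𝓝[≠] t₀] fun t => (w t)⁻¹ := hw.mono fun z hz => by
    simp [hu, hz]
  have key : ∀ᶠ z in 𝓝[≠] t₀, deriv u z = ε / z - ε * χinf / z * u z + u z ^ 2 * x z ∧
      deriv x z = (-1 + ε * χinf) / z * x z - χ₀ / z + u z - u z * x z ^ 2 := by
    filter_upwards [eventually_nhdsNE_eventually_nhds huw, eventually_nhdsNE_eventually_nhds hX, he,
      eventually_analyticAt_of_eventuallyEq_div hh h0 hw,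
      (continuousAt_id.eventually_ne ht₀).filter_mono nhdsWithin_le_nhds]
      with z h1 h2 heq hwz hz0
    simp only [id] at hz0
    rw [pIIIPrimeAt_iff_deriv_riccatiDefect hε hz0 hwz.1 hwz.2, EventuallyEq.deriv_eq h2,
      h2.self_of_nhds] at heq
    have h3 := h2.self_of_nhds
    have hw0 := hwz.2
    rw [EventuallyEq.deriv_eq h1, h1.self_of_nhds,
      (hwz.1.differentiableAt.hasDerivAt.fun_inv hwz.2).deriv]
    rw [riccatiDefect] at h3
    constructor
    · rw [← h3]
      field_simp
      ring
    · refine mul_right_cancel₀ hw0 (heq.trans ?_)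
      field_simp
  have k1 := AnalyticAt.eventuallyEq_nhds hdu (by fun_prop (disch := assumption))
    (key.mono fun z hz => hz.1)
  have k2 := AnalyticAt.eventuallyEq_nhds hdx (by fun_prop (disch := assumption))
    (key.mono fun z hz => hz.2)
  filter_upwards [k1, k2, hua.eventually_analyticAt, hx.eventually_analyticAt] with z e1 e2 e3 e4
  have d1 := e3.differentiableAt.hasDerivAt
  have d2 := e4.differentiableAt.hasDerivAt
  rw [e1] at d1
  rw [e2] at d2
  exact (hasDerivAt_id z).prodMk (d1.prodMk d2)

/-- Every regular value of the Riccati defect is attained by a solution with a pole of residue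
`ε t₀`. -/
theorem exists_solution_of_riccatiDefect {ε t₀ : ℂ} (χ₀ χinf : ℂ) (hε : ε ^ 2 = 1) (ht₀ : t₀ ≠ 0)
    (x₀ : ℂ) : ∃ w h x : ℂ → ℂ, AnalyticAt ℂ h t₀ ∧ h t₀ = ε * t₀ ∧
      w =ᶠ[𝓝[≠] t₀] (fun t => h t / (t - t₀)) ∧ (∀ᶠ z in 𝓝 t₀, MeromorphicAt w z) ∧
      (∀ᶠ z in 𝓝[≠] t₀, PIIIPrimeAt χ₀ χinf w z) ∧ AnalyticAt ℂ x t₀ ∧ x t₀ = x₀ ∧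
      riccatiDefect ε χinf w =ᶠ[𝓝[≠] t₀] x := by
  have hε0 : ε ≠ 0 := by rintro rfl; simp at hε
  obtain ⟨r, hr, y, hy0, hy⟩ := exists_forall_hasDerivAt_ball_of_contDiffAt
    (contDiffAt_pIIIField ε χ₀ χinf (p := (t₀, 0, x₀)) ht₀) t₀
  have hyd : ∀ᶠ z in 𝓝 t₀, HasDerivAt y (pIIIField ε χ₀ χinf (y z)) z :=
    eventually_of_mem (Metric.ball_mem_nhds t₀ hr) hy
  -- The first component has derivative `1` and value `t₀` at `t₀`, so it is the independent
  -- variable.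
  have hy1 : (fun z => (y z).1) =ᶠ[𝓝 t₀] id :=
    eventuallyEq_of_hasDerivAt_of_contDiffAt (f := fun _ => (1 : ℂ)) contDiffAt_const
      (by simp [hy0]) (hyd.mono fun z hz => hz.fst) (Eventually.of_forall hasDerivAt_id)
  set u : ℂ → ℂ := fun z => (y z).2.1 with hu
  set x : ℂ → ℂ := fun z => (y z).2.2 with hx
  have hsys : ∀ᶠ z in 𝓝 t₀, HasDerivAt u (ε / z - ε * χinf / z * u z + u z ^ 2 * x z) z ∧
      HasDerivAt x ((-1 + ε * χinf) / z * x z - χ₀ / z + u z - u z * x z ^ 2) z := by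
    filter_upwards [hyd, hy1] with z hz h1
    have h1 : (y z).1 = z := h1
    have := hz
    simp only [pIIIField, h1] at this
    exact ⟨this.snd.fst, this.snd.snd⟩
  have hua : AnalyticAt ℂ u t₀ := Complex.analyticAt_iff_eventually_differentiableAt.2
    (hsys.mono fun z hz => hz.1.differentiableAt)
  have hxa : AnalyticAt ℂ x t₀ := Complex.analyticAt_iff_eventually_differentiableAt.2
    (hsys.mono fun z hz => hz.2.differentiableAt)
  have hu0 : u t₀ = 0 := by simp [hu, hy0]
  have hx0 : x t₀ = x₀ := by simp [hx, hy0]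
  -- The zero of `u` is simple with slope `ε / t₀`, so `1 / u` has a simple pole of residue `t₀ / ε
  -- = ε * t₀`.
  have hdu : dslope u t₀ t₀ = ε / t₀ := by
    rw [dslope_same, hsys.self_of_nhds.1.deriv, hu0]
    ring
  have hdu0 : dslope u t₀ t₀ ≠ 0 := by rw [hdu]; exact div_ne_zero hε0 ht₀
  have hne : ∀ᶠ z in 𝓝[≠] t₀, u z ≠ 0 := by
    filter_upwards [(hua.dslope_self.continuousAt.eventually_ne hdu0).filter_mono
      nhdsWithin_le_nhds, self_mem_nhdsWithin] with z hz hzt h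
    rw [dslope_of_ne _ hzt, slope_def_field, hu0, h] at hz
    simp at hz
  have hX : ∀ᶠ z in 𝓝[≠] t₀, riccatiDefect ε χinf (fun t => (u t)⁻¹) z = x z := by
    filter_upwards [hne, hsys.filter_mono nhdsWithin_le_nhds,
      (continuousAt_id.eventually_ne ht₀).filter_mono nhdsWithin_le_nhds] with z h1 h2 hz0
    simp only [id] at hz0
    rw [riccatiDefect, (h2.1.fun_inv h1).deriv]
    field_simp
    ring
  refine ⟨fun t => (u t)⁻¹, fun t => (dslope u t₀ t)⁻¹, x, hua.dslope_self.inv hdu0, ?_, ?_, ?_, ?_,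
    hxa, hx0, hX⟩
  · simp only [hdu]
    field_simp
    linear_combination -hε
  · filter_upwards [self_mem_nhdsWithin] with z hz
    have hs : z - t₀ ≠ 0 := sub_ne_zero.2 hz
    rw [dslope_of_ne _ hz, slope_def_field, hu0, sub_zero]
    field_simp
  · exact hua.eventually_analyticAt.mono fun z hz => hz.meromorphicAt.inv
  · filter_upwards [hne, eventually_nhdsNE_eventually_nhds hX, hsys.filter_mono nhdsWithin_le_nhds,
      (continuousAt_id.eventually_ne ht₀).filter_mono nhdsWithin_le_nhds,
      hua.eventually_analyticAt.filter_mono nhdsWithin_le_nhds] with z h1 h2 h3 hz0 h4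
    simp only [id] at hz0
    rw [pIIIPrimeAt_iff_deriv_riccatiDefect hε hz0 (h4.fun_inv h1) (inv_ne_zero h1),
      EventuallyEq.deriv_eq h2, h2.self_of_nhds, h3.2.deriv]
    field_simp

/-! ### Uniqueness near the pole and the main theorem. -/

theorem eq_of_residue_sq {t₀ a : ℂ} (ht₀ : t₀ ≠ 0) (h : a ^ 2 = t₀ ^ 2) :
    ∃ ε : ℂ, ε ^ 2 = 1 ∧ a = ε * t₀ :=
  ⟨a / t₀, by rw [div_pow, h, div_self (pow_ne_zero 2 ht₀)], (div_mul_cancel₀ _ ht₀).symm⟩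

theorem exists_isOpen_of_eventually_nhdsNE {p q : ℂ → Prop} {t₀ : ℂ} (hp : ∀ᶠ z in 𝓝 t₀, p z)
    (hq : ∀ᶠ z in 𝓝[≠] t₀, q z) : ∃ U : Set ℂ, IsOpen U ∧ t₀ ∈ U ∧ (∀ z ∈ U, p z) ∧
      ∀ z ∈ U, ∀ᶠ y in 𝓝[≠] z, q y := by
  obtain ⟨U, hU, hUo, htU⟩ := eventually_nhds_iff.1 (hp.and (eventually_nhdsWithin_iff.1 hq))
  refine ⟨U, hUo, htU, fun z hz => (hU z hz).1, fun z hz => ?_⟩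
  by_cases hzt : z = t₀
  · rwa [hzt]
  · filter_upwards [mem_nhdsWithin_of_mem_nhds (hUo.mem_nhds hz),
      mem_nhdsWithin_of_mem_nhds (isOpen_compl_singleton.mem_nhds hzt)] with y hy hyt
    exact (hU y hy).2 hyt

/-- Equal residues give the same `ε`, and equal derivatives then give equal defects at `t₀`; both
solutions yield the same initial data for the regular system. -/
theorem eventuallyEq_of_residueAt_eq {χ₀ χinf t₀ : ℂ} {w₁ w₂ : ℂ → ℂ} (ht₀ : t₀ ≠ 0)
    (he₁ : ∀ᶠ z in 𝓝[≠] t₀, PIIIPrimeAt χ₀ χinf w₁ z) (hp₁ : HasSimplePoleAt w₁ t₀)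
    (he₂ : ∀ᶠ z in 𝓝[≠] t₀, PIIIPrimeAt χ₀ χinf w₂ z) (hp₂ : HasSimplePoleAt w₂ t₀)
    (hres : residueAt w₁ t₀ = residueAt w₂ t₀)
    (hder : deriv (regularPartAt w₁ t₀) t₀ = deriv (regularPartAt w₂ t₀) t₀) :
    w₁ =ᶠ[𝓝[≠] t₀] w₂ := by
  obtain ⟨h₁, ha₁, hn₁, hw₁⟩ := hp₁.exists_analyticAt_div
  obtain ⟨h₂, ha₂, hn₂, hw₂⟩ := hp₂.exists_analyticAt_div
  rw [residueAt_eq_of_eventuallyEq_div ha₁ hw₁, residueAt_eq_of_eventuallyEq_div ha₂ hw₂] at hres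
  rw [(regularPartAt_eventuallyEq ha₁ hw₁).deriv_eq,
    (regularPartAt_eventuallyEq ha₂ hw₂).deriv_eq] at hder
  obtain ⟨ε, hε, h0₁⟩ := eq_of_residue_sq ht₀ (residue_sq_eq ht₀ ha₁ hn₁ hw₁ he₁)
  have h0₂ := hres.symm.trans h0₁
  obtain ⟨x₁, hx₁, hX₁⟩ := exists_analyticAt_riccatiDefect hε ht₀ ha₁ h0₁ hw₁ he₁
  obtain ⟨x₂, hx₂, hX₂⟩ := exists_analyticAt_riccatiDefect hε ht₀ ha₂ h0₂ hw₂ he₂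
  rw [deriv_dslope_of_riccatiDefect hε ht₀ ha₁ h0₁ hw₁ hx₁ hX₁,
    deriv_dslope_of_riccatiDefect hε ht₀ ha₂ h0₂ hw₂ hx₂ hX₂] at hder
  have hx : x₁ t₀ = x₂ t₀ := by linear_combination -3 * hder
  have hu := eventuallyEq_of_hasDerivAt_of_contDiffAt
    (contDiffAt_pIIIField ε χ₀ χinf ht₀) (by simp [hx])
    (eventually_hasDerivAt_pIIIField hε ht₀ ha₁ hn₁ hw₁ he₁ hx₁ hX₁)
    (eventually_hasDerivAt_pIIIField hε ht₀ ha₂ hn₂ hw₂ he₂ hx₂ hX₂)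
  filter_upwards [hw₁, hw₂, hu.filter_mono nhdsWithin_le_nhds] with z e₁ e₂ e
  rw [e₁, e₂, ← inv_div, ← inv_div (z - t₀) (h₂ z)]
  exact congrArg (fun p : ℂ × ℂ × ℂ => p.2.1⁻¹) e

theorem mainTheorem6 (χ₀ χinf t₀ : ℂ) (ht₀ : t₀ ≠ 0) :
    -- every solution with a simple pole at `t₀` belongs to one of the two families,
    -- and the derivative that labels it is well defined
    (∀ (U : Set ℂ) (w : ℂ → ℂ), IsOpen U → t₀ ∈ U →
      IsMeromorphicSolutionOn χ₀ χinf w U → HasSimplePoleAt w t₀ →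
        (residueAt w t₀ = t₀ ∨ residueAt w t₀ = -t₀) ∧ AnalyticAt ℂ (regularPartAt w t₀) t₀) ∧
    -- in each family the derivative takes every value
    (∀ ρ : ℂ, (ρ = t₀ ∨ ρ = -t₀) → ∀ c : ℂ,
      ∃ (U : Set ℂ) (w : ℂ → ℂ), IsOpen U ∧ t₀ ∈ U ∧
        IsMeromorphicSolutionOn χ₀ χinf w U ∧ HasSimplePoleAt w t₀ ∧
        residueAt w t₀ = ρ ∧ deriv (regularPartAt w t₀) t₀ = c) ∧
    -- in each family the derivative identifies the solution
    (∀ (U : Set ℂ) (w₁ w₂ : ℂ → ℂ), IsOpen U → IsPreconnected U → t₀ ∈ U →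
      IsMeromorphicSolutionOn χ₀ χinf w₁ U → HasSimplePoleAt w₁ t₀ →
      IsMeromorphicSolutionOn χ₀ χinf w₂ U → HasSimplePoleAt w₂ t₀ →
      residueAt w₁ t₀ = residueAt w₂ t₀ →
      deriv (regularPartAt w₁ t₀) t₀ = deriv (regularPartAt w₂ t₀) t₀ →
        ∀ t ∈ U, w₁ =ᶠ[𝓝[≠] t] w₂) := by
  refine ⟨fun U w _ htU hw hp => ?_, fun ρ hρ c => ?_,
    fun U w₁ w₂ _ hUc htU hw₁ hp₁ hw₂ hp₂ hres hder t ht => ?_⟩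
  · obtain ⟨h, hh, h0, he⟩ := hp.exists_analyticAt_div
    refine ⟨?_, hh.dslope_self.congr (regularPartAt_eventuallyEq hh he).symm⟩
    rw [residueAt_eq_of_eventuallyEq_div hh he]
    exact sq_eq_sq_iff_eq_or_eq_neg.1 (residue_sq_eq ht₀ hh h0 he (hw.equation t₀ htU))
  · obtain ⟨ε, hε, rfl⟩ := eq_of_residue_sq ht₀ (sq_eq_sq_iff_eq_or_eq_neg.2 hρ)
    -- The prescribed defect is the formula of `deriv_dslope_of_riccatiDefect` solved for `x t₀`
    -- when the derivative is `c`.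
    obtain ⟨w, h, x, hh, h0, hw, hm, he, hx, hx0, hX⟩ := exists_solution_of_riccatiDefect χ₀ χinf hε
      ht₀ (-3 * c - ε * ((ε + χinf) / 2 * ((ε + χinf) / 2 - χinf)) / t₀)
    have hρ0 : ε * t₀ ≠ 0 := by rcases hρ with hρ | hρ <;> simp [hρ, ht₀]
    obtain ⟨U, hU, htU, hUm, hUe⟩ := exists_isOpen_of_eventually_nhdsNE hm he
    refine ⟨U, w, hU, htU, ⟨hUm, hUe⟩,
      hasSimplePoleAt_of_eventuallyEq_div hh (h0 ▸ hρ0) hw,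
      (residueAt_eq_of_eventuallyEq_div hh hw).trans h0, ?_⟩
    rw [(regularPartAt_eventuallyEq hh hw).deriv_eq,
      deriv_dslope_of_riccatiDefect hε ht₀ hh h0 hw hx hX, hx0]
    field_simp
    ring
  · have hd := hw₁.meromorphicOn.sub hw₂.meromorphicOn
    -- Order `⊤` means vanishing on a punctured neighbourhood; on a preconnected set it propagates
    -- from `t₀` to every point.
    have htop : meromorphicOrderAt (w₁ - w₂) t₀ = ⊤ := by
      rw [meromorphicOrderAt_eq_top_iff]
      filter_upwards [eventuallyEq_of_residueAt_eq ht₀ (hw₁.equation t₀ htU) hp₁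
        (hw₂.equation t₀ htU) hp₂ hres hder] with z hz
      simp [hz]
    have := not_imp_not.1 (hd.meromorphicOrderAt_ne_top_of_isPreconnected hUc ht htU) htop
    filter_upwards [meromorphicOrderAt_eq_top_iff.1 this] with z hz
    exact sub_eq_zero.1 hz
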